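/- Let $\hat{\mathsf G}$ be a finite group, let $\pi:\hat{\mathsf G}\to\mathbb Z_2=\{\pm1\}$ be a non-trivial homomorphism, and put $\mathsf G=\ker\pi$. Let $M$ be a connected smooth manifold, possibly with boundary or corners, with a base point $m_0$, and let $\mathrm{or}_M\to M$ be its orientation double cover. Write also $\mathrm{or}_M:\pi_1(M,m_0)\to\mathbb Z_2$ for the orientation character of $M$, that is, the holonomy of the orientation double cover. Let $\mathcal{B}\mathrm{un}^{\mathrm{or}}_{\hat{\mathsf G}}(M)$ be the groupoid of orientation twisted principal bundles on $M$. Its objects are pairs $(P,\epsilon)$, where $P\to M$ is a principal $\hat{\mathsf G}$-bundle and $\epsilon: P\times^{\pi}_{\hat{\mathsf G}}\mathbb Z_2\xrightarrow{\ \sim\ }\mathrm{or}_M$ is an isomorphism of double covers of $M$. Its morphisms $(P,\epsilon)\to(P',\epsilon')$ are the morphisms $f:P\to P'$ of principal $\hat{\mathsf G}$-bundles over $M$ with $\epsilon'\circ(f\times^{\pi}_{\hat{\mathsf G}}\mathrm{id}_{\mathbb Z_2})=\epsilon$. (This is the homotopy fibre of $P\mapsto P\times^{\pi}_{\hat{\mathsf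 G}}\mathbb Z_2$ over $\mathrm{or}_M$.) **Proposition.** There is an equivalence of groupoids $$\mathcal{B}\mathrm{un}^{\mathrm{or}}_{\hat{\mathsf G}}(M)\;\simeq\;\mathrm{Hom}^{\mathrm{or}_M}\big(\pi_1(M,m_0),\hat{\mathsf G}\big)/\!\!/\mathsf G ,$$ where $\mathrm{Hom}^{\mathrm{or}_M}(\pi_1(M,m_0),\hat{\mathsf G})$ is the set of group homomorphisms $\rho:\pi_1(M,m_0)\to\hat{\mathsf G}$ with $\pi\circ\rho=\mathrm{or}_M$, the group $\mathsf G$ acts on it by conjugation, and $/\!\!/$ denotes the action groupoid. -/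

import Mathlib

open CategoryTheory MulOpposite
open Bundle (Trivialization TotalSpace)
open scoped ContDiff RightActions

set_option linter.unusedSectionVars false

noncomputable section

universe w u v v' e h

/-! ### Principal bundles -/

/-- A principal `G`-bundle on `M`: a space `P` over `M` with a right action of `G`, written `p <• g`,
such that every point of `M` has an open neighbourhood `U` over which `P` is `G`-equivariantly
homeomorphic over `U` to `U × G`, where `G` acts on `U × G` by right multiplication on `G`.
(Continuity of the projection and of the action follows from local triviality.) -/
structure PrincipalBundle (G : Type v) [Group G] [TopologicalSpace G]
    (M : Type u) [TopologicalSpace M] where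
  /-- The total space. -/
  Total : Type w
  [topologicalSpace : TopologicalSpace Total]
  [action : MulAction Gᵐᵒᵖ Total]
  /-- The projection to the base. -/
  proj : Total → M
  proj_smul : ∀ (p : Total) (g : G), proj (p <• g) = proj p
  locallyTrivial : ∀ x : M, ∃ t : Trivialization G proj, x ∈ t.baseSet ∧
    ∀ p ∈ t.source, ∀ g : G, (t (p <• g)).2 = (t p).2 * g

namespace PrincipalBundle

attribute [instance] topologicalSpace action

section Basic

variable {G : Type v} [Group G] [TopologicalSpace G] {M : Type u} [TopologicalSpace M]

theorem smul_one' (P : PrincipalBundle.{w} G M) (p : P.Total) : p <• (1 : G) = p :=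
  one_smul Gᵐᵒᵖ p

theorem smul_mul' (P : PrincipalBundle.{w} G M) (p : P.Total) (g g' : G) :
    p <• (g * g') = (p <• g) <• g' := by
  rw [op_mul, mul_smul]

/-- The action is free and transitive on every fibre. -/
theorem existsUnique_smul (P : PrincipalBundle.{w} G M) (p q : P.Total)
    (hpq : P.proj p = P.proj q) : ∃! g : G, p <• g = q := by
  obtain ⟨t, hx, ht⟩ := P.locallyTrivial (P.proj p)
  have hp : p ∈ t.source := t.mem_source.2 hx
  have hq : q ∈ t.source := t.mem_source.2 (hpq ▸ hx)
  refine ⟨(t p).2⁻¹ * (t q).2, ?_, ?_⟩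
  · have hg : (p <• ((t p).2⁻¹ * (t q).2)) ∈ t.source := t.mem_source.2 (by rwa [P.proj_smul])
    refine t.injOn hg hq (Prod.ext ?_ ?_)
    · exact (t.coe_fst hg).trans (((P.proj_smul _ _).trans hpq).trans (t.coe_fst hq).symm)
    · exact (ht p hp _).trans (mul_inv_cancel_left _ _)
  · rintro g rfl
    rw [ht p hp]; group

theorem eq_of_smul_eq (P : PrincipalBundle.{w} G M) {p : P.Total} {g g' : G}
    (hg : p <• g = p <• g') : g = g' :=
  (P.existsUnique_smul p (p <• g') (P.proj_smul p g').symm).unique hg rfl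

/-- A morphism of principal `G`-bundles on `M`: a continuous `G`-equivariant map over `M`. -/
@[ext]
structure Hom (P Q : PrincipalBundle.{w} G M) where
  toFun : P.Total → Q.Total
  continuous_toFun : Continuous toFun
  map_smul : ∀ (p : P.Total) (g : G), toFun (p <• g) = toFun p <• g
  proj_map : ∀ p : P.Total, Q.proj (toFun p) = P.proj p

/-- The category of principal `G`-bundles on `M`. -/
instance : Category (PrincipalBundle.{w} G M) where
  Hom := Hom
  id P := ⟨id, continuous_id, fun _ _ => rfl, fun _ => rfl⟩
  comp f g := ⟨g.toFun ∘ f.toFun, g.continuous_toFun.comp f.continuous_toFun,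
    fun p a => by simp [f.map_smul, g.map_smul], fun p => by simp [f.proj_map, g.proj_map]⟩

@[ext]
theorem hom_ext {P Q : PrincipalBundle.{w} G M} {f g : P ⟶ Q}
    (hfg : ∀ p, f.toFun p = g.toFun p) : f = g :=
  Hom.ext (funext hfg)

end Basic

section Discrete

variable {G : Type v} [Group G] [TopologicalSpace G] [DiscreteTopology G]
  {M : Type u} [TopologicalSpace M]

theorem isCoveringMap (P : PrincipalBundle.{w} G M) : IsCoveringMap P.proj := by
  choose t ht _ using P.locallyTrivial
  exact IsCoveringMap.mk _ (fun _ => G) t ht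

theorem continuous_smul' (P : PrincipalBundle.{w} G M) (g : G) :
    Continuous fun p : P.Total => p <• g := by
  rw [continuous_iff_continuousAt]
  intro p
  obtain ⟨t, hx, ht⟩ := P.locallyTrivial (P.proj p)
  have hp : p ∈ t.source := t.mem_source.2 hx
  have h1 : ContinuousOn (fun q => t.toOpenPartialHomeomorph.symm ((t q).1, (t q).2 * g))
      t.source := by
    refine t.toOpenPartialHomeomorph.continuousOn_symm.comp
      ((continuous_fst.prodMk (continuous_snd.mul continuous_const)).comp_continuousOn
        t.continuousOn_toFun) fun q hq => ?_
    exact t.mem_target.2 (by simpa [t.coe_fst hq] using t.mem_source.1 hq)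
  refine ((h1.congr fun q hq => ?_).continuousAt (t.open_source.mem_nhds hp))
  have hg : (q <• g) ∈ t.source := t.mem_source.2 (by rw [P.proj_smul]; exact t.mem_source.1 hq)
  have h2 : ((t q).1, (t q).2 * g) = t (q <• g) :=
    Prod.ext (by rw [t.coe_fst hq, t.coe_fst hg, P.proj_smul]) (ht q hq g).symm
  simp only [h2]
  exact (t.toOpenPartialHomeomorph.left_inv hg).symm

/-! ### Holonomy -/

variable {m : M}

/-- The holonomy of `P` along the homotopy class of loops `γ`, with respect to the point `p` of the
fibre over the base point: the unique `g` such that the lift of `γ` starting at `p` ends at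
`p <• g`. -/
def holonomyFun (P : PrincipalBundle.{w} G M) (p : P.proj ⁻¹' {m})
    (γ : FundamentalGroup M m) : G :=
  (P.existsUnique_smul p.1 (P.isCoveringMap.monodromy γ p).1
    (p.2.trans (P.isCoveringMap.monodromy γ p).2.symm)).choose

theorem smul_holonomyFun (P : PrincipalBundle.{w} G M) (p : P.proj ⁻¹' {m})
    (γ : FundamentalGroup M m) :
    p.1 <• P.holonomyFun p γ = (P.isCoveringMap.monodromy γ p).1 :=
  (P.existsUnique_smul p.1 (P.isCoveringMap.monodromy γ p).1
    (p.2.trans (P.isCoveringMap.monodromy γ p).2.symm)).choose_spec.1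

/-- Monodromy commutes with the action of the structure group. -/
theorem monodromy_smul (P : PrincipalBundle.{w} G M) (p q : P.proj ⁻¹' {m}) (g : G)
    (hq : q.1 = p.1 <• g) (γ : FundamentalGroup M m) :
    (P.isCoveringMap.monodromy γ q).1 = (P.isCoveringMap.monodromy γ p).1 <• g := by
  obtain ⟨q, hq'⟩ := q
  obtain rfl : q = p.1 <• g := hq
  obtain ⟨γ⟩ := γ
  have key : ((P.isCoveringMap.liftPath γ (p.1 <• g) (γ.source.trans hq'.symm)) : C(_, P.Total)) =
      ⟨fun s => P.isCoveringMap.liftPath γ p.1 (γ.source.trans p.2.symm) s <• g,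
        (P.continuous_smul' g).comp (ContinuousMap.continuous _)⟩ := by
    refine ((P.isCoveringMap.eq_liftPath_iff' _).2 ⟨?_, ?_⟩).symm
    · funext s
      have := congr_fun
        (P.isCoveringMap.liftPath_lifts γ.toContinuousMap p.1 (γ.source.trans p.2.symm)) s
      exact (P.proj_smul _ g).trans this
    · simp [P.isCoveringMap.liftPath_zero]
  exact congr($key 1)

/-- The holonomy representation of a principal bundle. -/
def holonomy (P : PrincipalBundle.{w} G M) (p : P.proj ⁻¹' {m}) : FundamentalGroup M m →* G where
  toFun := P.holonomyFun p
  map_one' := by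
    apply P.eq_of_smul_eq (p := p.1)
    rw [P.smul_holonomyFun, P.smul_one']
    exact congr_arg Subtype.val (congr_fun P.isCoveringMap.monodromy_refl p)
  map_mul' γ δ := by
    apply P.eq_of_smul_eq (p := p.1)
    rw [P.smul_holonomyFun, P.smul_mul', P.smul_holonomyFun]
    have h1 := P.isCoveringMap.monodromy_trans_apply δ γ p
    refine (congr_arg Subtype.val h1).trans ?_
    exact P.monodromy_smul p _ _ (P.smul_holonomyFun p δ).symm γ

/-- Every morphism of principal bundles is bijective. -/
theorem bijective_hom {P Q : PrincipalBundle.{w} G M} (f : P ⟶ Q) :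
    Function.Bijective f.toFun := by
  constructor
  · intro p q hpq
    have h1 : P.proj p = P.proj q := by rw [← f.proj_map, hpq, f.proj_map]
    obtain ⟨g, rfl, _⟩ := P.existsUnique_smul p q h1
    have h2 : f.toFun p <• (1 : G) = f.toFun p <• g := by
      rw [Q.smul_one', ← f.map_smul, ← hpq]
    rw [← Q.eq_of_smul_eq h2, P.smul_one']
  · intro q
    obtain ⟨t, hx, _⟩ := P.locallyTrivial (Q.proj q)
    obtain ⟨p, hp⟩ : ∃ p, P.proj p = Q.proj q :=
      ⟨t.toOpenPartialHomeomorph.symm (Q.proj q, 1), t.proj_symm_apply' hx⟩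
    obtain ⟨g, hg, _⟩ := Q.existsUnique_smul (f.toFun p) q ((f.proj_map p).trans hp)
    exact ⟨p <• g, (f.map_smul p g).trans hg⟩

theorem isHomeomorph_hom {P Q : PrincipalBundle.{w} G M} (f : P ⟶ Q) :
    IsHomeomorph f.toFun := by
  have hc : IsLocalHomeomorph (Q.proj ∘ f.toFun) := by
    rw [show Q.proj ∘ f.toFun = P.proj from funext f.proj_map]
    exact P.isCoveringMap.isLocalHomeomorph
  have hl : IsLocalHomeomorph f.toFun :=
    hc.of_comp Q.isCoveringMap.isLocalHomeomorph f.continuous_toFun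
  exact ⟨f.continuous_toFun, hl.isOpenMap, bijective_hom f⟩

/-- The groupoid of principal `G`-bundles on `M`. -/
instance : Groupoid (PrincipalBundle.{w} G M) where
  inv {P Q} f :=
    { toFun := ((isHomeomorph_hom f).homeomorph f.toFun).symm
      continuous_toFun := Homeomorph.continuous _
      map_smul := fun q g => by
        rw [Homeomorph.symm_apply_eq]
        simp only [IsHomeomorph.homeomorph_apply, f.map_smul]
        congr 1
        exact (Homeomorph.apply_symm_apply ((isHomeomorph_hom f).homeomorph f.toFun) q).symm
      proj_map := fun q => by
        rw [← f.proj_map]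
        congr 1
        exact Homeomorph.apply_symm_apply ((isHomeomorph_hom f).homeomorph f.toFun) q }
  inv_comp {P Q} f := hom_ext fun q =>
    Homeomorph.apply_symm_apply ((isHomeomorph_hom f).homeomorph f.toFun) q
  comp_inv {P Q} f := hom_ext fun p =>
    Homeomorph.symm_apply_apply ((isHomeomorph_hom f).homeomorph f.toFun) p

end Discrete

/-! ### Change of structure group -/

section Induced

variable {G : Type v} [Group G] [TopologicalSpace G] [DiscreteTopology G]
  {K : Type v'} [Group K] [TopologicalSpace K] [DiscreteTopology K]
  {M : Type u} [TopologicalSpace M]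

/-- The equivalence relation on `P × K` generating the associated bundle:
`(p <• g, k) ∼ (p, φ g * k)`. -/
def inducedSetoid (φ : G →* K) (P : PrincipalBundle.{w} G M) : Setoid (P.Total × K) where
  r a b := ∃ g : G, a.1 = b.1 <• g ∧ b.2 = φ g * a.2
  iseqv :=
    { refl := fun a => ⟨1, (P.smul_one' a.1).symm, by simp⟩
      symm := by
        rintro ⟨_, k⟩ ⟨q, _⟩ ⟨g, rfl, h⟩
        have h' := h
        simp only at h'
        exact ⟨g⁻¹, by rw [← P.smul_mul']; simp, by simp [h']⟩
      trans := by
        rintro ⟨_, k⟩ ⟨_, l⟩ ⟨q, n⟩ ⟨g, rfl, h⟩ ⟨g', rfl, h'⟩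
        exact ⟨g' * g, by rw [P.smul_mul'], by simp_all [mul_assoc]⟩ }

/-- The total space `P ×_G K` of the associated bundle, with the quotient topology. -/
def InducedTotal (φ : G →* K) (P : PrincipalBundle.{w} G M) : Type (max w v') :=
  Quotient (inducedSetoid φ P)

instance (φ : G →* K) (P : PrincipalBundle.{w} G M) : TopologicalSpace (InducedTotal φ P) :=
  inferInstanceAs (TopologicalSpace (Quotient (inducedSetoid φ P)))

/-- The class `[p, k]` in `P ×_G K`. -/
def inducedMk (φ : G →* K) (P : PrincipalBundle.{w} G M) (a : P.Total × K) : InducedTotal φ P :=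
  Quotient.mk (inducedSetoid φ P) a

/-- The right action `[p, k] <• k' = [p, k * k']`. -/
instance (φ : G →* K) (P : PrincipalBundle.{w} G M) : MulAction Kᵐᵒᵖ (InducedTotal φ P) where
  smul k' := Quotient.map (fun a => (a.1, a.2 * unop k'))
    (by rintro a b ⟨g, h1, h2⟩; exact ⟨g, h1, by simp [h2, mul_assoc]⟩)
  one_smul := by rintro ⟨p, k⟩; exact congr_arg (inducedMk φ P) (by simp)
  mul_smul := by rintro a b ⟨p, k⟩; exact congr_arg (inducedMk φ P) (by simp [mul_assoc])

theorem inducedMk_smul (φ : G →* K) (P : PrincipalBundle.{w} G M) (a : P.Total × K) (k : K) :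
    inducedMk φ P a <• k = inducedMk φ P (a.1, a.2 * k) := rfl

/-- The projection `[p, k] ↦ proj p`. -/
def inducedProj (φ : G →* K) (P : PrincipalBundle.{w} G M) : InducedTotal φ P → M :=
  Quotient.lift (fun a => P.proj a.1) (by rintro a b ⟨g, h1, _⟩; rw [h1, P.proj_smul])

theorem isQuotientMap_inducedMk (φ : G →* K) (P : PrincipalBundle.{w} G M) :
    Topology.IsQuotientMap (inducedMk φ P) := isQuotientMap_quotient_mk'

theorem continuous_inducedProj (φ : G →* K) (P : PrincipalBundle.{w} G M) :
    Continuous (inducedProj φ P) :=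
  (isQuotientMap_inducedMk φ P).continuous_iff.2 (P.isCoveringMap.continuous.comp continuous_fst)

open Classical in
/-- The local trivialization `[p, k] ↦ (proj p, φ g * k)` of `P ×_G K` defined by a local
trivialization `p ↦ (proj p, g)` of `P`. -/
def inducedTrivialization (φ : G →* K) (P : PrincipalBundle.{w} G M) (t : Trivialization G P.proj)
    (ht : ∀ p ∈ t.source, ∀ g : G, (t (p <• g)).2 = (t p).2 * g) :
    Trivialization K (inducedProj φ P) where
  toFun := Quotient.lift
    (fun a => (P.proj a.1, if P.proj a.1 ∈ t.baseSet then φ (t a.1).2 * a.2 else 1)) (by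
      rintro ⟨_, k⟩ ⟨q, l⟩ ⟨g, rfl, h⟩
      obtain rfl : l = φ g * k := h
      by_cases hq : P.proj q ∈ t.baseSet
      · simp [P.proj_smul, hq, ht q (t.mem_source.2 hq), mul_assoc]
      · simp [P.proj_smul, hq])
  invFun a := inducedMk φ P (t.toOpenPartialHomeomorph.symm (a.1, 1), a.2)
  source := inducedProj φ P ⁻¹' t.baseSet
  target := t.baseSet ×ˢ Set.univ
  map_source' := by rintro ⟨p, k⟩ hp; exact ⟨hp, trivial⟩
  map_target' := by
    rintro ⟨x, k⟩ ⟨hx, _⟩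
    change P.proj (t.toOpenPartialHomeomorph.symm (x, 1)) ∈ t.baseSet
    rwa [t.proj_symm_apply' hx]
  left_inv' := by
    rintro ⟨p, k⟩ hp
    have hp' : P.proj p ∈ t.baseSet := hp
    refine Quotient.sound ⟨(t p).2⁻¹, ?_, ?_⟩
    · have hs : p ∈ t.source := t.mem_source.2 hp'
      have hg : (p <• (t p).2⁻¹) ∈ t.source := t.mem_source.2 (by rwa [P.proj_smul])
      have : (P.proj p, (1 : G)) = t (p <• (t p).2⁻¹) :=
        Prod.ext (by rw [t.coe_fst hg, P.proj_smul]) (by rw [ht p hs]; simp)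
      simp only [this]
      exact t.toOpenPartialHomeomorph.left_inv hg
    · simp [hp']
  right_inv' := by
    rintro ⟨x, k⟩ ⟨hx, _⟩
    have h1 : P.proj (t.toOpenPartialHomeomorph.symm (x, 1)) = x := t.proj_symm_apply' hx
    have h2 : t (t.toOpenPartialHomeomorph.symm (x, 1)) = (x, 1) := t.apply_symm_apply' hx
    simp only [inducedMk, Quotient.lift_mk, h1, h2, if_pos hx, map_one, one_mul]
  continuousOn_toFun := by
    refine ((isQuotientMap_inducedMk φ P).continuousOn_isOpen_iff
      (t.open_baseSet.preimage (continuous_inducedProj φ P))).2 ?_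
    have h1 : ContinuousOn (fun a : P.Total × K => (P.proj a.1, φ (t a.1).2 * a.2))
        (Prod.fst ⁻¹' t.source) := by
      refine (P.isCoveringMap.continuous.comp continuous_fst).continuousOn.prodMk ?_
      refine ContinuousOn.mul ?_ continuous_snd.continuousOn
      exact (continuous_of_discreteTopology (f := φ)).comp_continuousOn
        (continuous_snd.comp_continuousOn
          (t.continuousOn_toFun.comp continuous_fst.continuousOn fun _ ha => ha))
    have h2 : inducedMk φ P ⁻¹' (inducedProj φ P ⁻¹' t.baseSet) = Prod.fst ⁻¹' t.source := by
      rw [t.source_eq]; rfl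
    rw [h2]
    refine h1.congr ?_
    rintro ⟨p, k⟩ hp
    have hp' : P.proj p ∈ t.baseSet := t.mem_source.1 hp
    change (P.proj p, if P.proj p ∈ t.baseSet then φ (t p).2 * k else 1) = _
    rw [if_pos hp']
  continuousOn_invFun := by
    refine (isQuotientMap_inducedMk φ P).continuous.comp_continuousOn ?_
    refine ContinuousOn.prodMk ?_ continuous_snd.continuousOn
    refine t.toOpenPartialHomeomorph.continuousOn_symm.comp
      (continuous_fst.prodMk continuous_const).continuousOn ?_
    rintro ⟨x, k⟩ ⟨hx, _⟩
    exact t.mem_target.2 hx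
  open_source := t.open_baseSet.preimage (continuous_inducedProj φ P)
  open_target := t.open_baseSet.prod isOpen_univ
  baseSet := t.baseSet
  open_baseSet := t.open_baseSet
  source_eq := rfl
  target_eq := rfl
  proj_toFun := by rintro ⟨p, k⟩ _; rfl

open Classical in
/-- The associated principal `K`-bundle `P ×_G K`. -/
def induced (φ : G →* K) (P : PrincipalBundle.{w} G M) : PrincipalBundle.{max w v'} K M where
  Total := InducedTotal φ P
  proj := inducedProj φ P
  proj_smul := by rintro ⟨p, k⟩ k'; rfl
  locallyTrivial x := by
    obtain ⟨t, hx, ht⟩ := P.locallyTrivial x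
    refine ⟨inducedTrivialization φ P t ht, hx, ?_⟩
    rintro ⟨p, k⟩ hp k'
    have hp' : P.proj p ∈ t.baseSet := hp
    change (if P.proj p ∈ t.baseSet then φ (t p).2 * (k * k') else 1) =
      (if P.proj p ∈ t.baseSet then φ (t p).2 * k else 1) * k'
    simp [hp', mul_assoc]

/-- The functor `P ↦ P ×_G K` from principal `G`-bundles to principal `K`-bundles induced by a
homomorphism `φ : G →* K`; on morphisms it is `f ↦ ([p, k] ↦ [f p, k])`. -/
def ind (M : Type u) [TopologicalSpace M] (φ : G →* K) :
    PrincipalBundle.{w} G M ⥤ PrincipalBundle.{max w v'} K M where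
  obj P := induced φ P
  map {P Q} f :=
    { toFun := Quotient.map (fun a => (f.toFun a.1, a.2))
        (by rintro a b ⟨g, h1, h2⟩; exact ⟨g, by simp [h1, f.map_smul], h2⟩)
      continuous_toFun := (isQuotientMap_inducedMk φ P).continuous_iff.2
        ((isQuotientMap_inducedMk φ Q).continuous.comp
          (f.continuous_toFun.prodMap continuous_id))
      map_smul := by rintro ⟨p, k⟩ k'; rfl
      proj_map := by rintro ⟨p, k⟩; exact f.proj_map p }
  map_id P := hom_ext (by rintro ⟨p, k⟩; rfl)
  map_comp f g := hom_ext (by rintro ⟨p, k⟩; rfl)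

end Induced

end PrincipalBundle

/-! ### The orientation double cover -/

section Orientation

variable (E : Type e) [NormedAddCommGroup E] [NormedSpace ℝ E]

/-- The two orientations of the vector space `E`. -/
abbrev VectorOrientation : Type e := Orientation ℝ E (Fin (Module.finrank ℝ E))

/-- The set of orientations of a vector space is regarded as a discrete space. -/
instance : TopologicalSpace (VectorOrientation E) := ⊥

instance : DiscreteTopology (VectorOrientation E) := ⟨rfl⟩

variable {E}

open Classical in
/-- The effect of an invertible linear map `A` on orientations: they are preserved if `det A > 0`
and reversed otherwise. -/
def transportOrientation (A : E →L[ℝ] E) (o : VectorOrientation E) : VectorOrientation E :=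
  if 0 < LinearMap.det (A : E →ₗ[ℝ] E) then o else -o

theorem transportOrientation_of_pos {A : E →L[ℝ] E} (hA : 0 < LinearMap.det (A : E →ₗ[ℝ] E))
    (o : VectorOrientation E) : transportOrientation A o = o := if_pos hA

theorem transportOrientation_of_neg {A : E →L[ℝ] E} (hA : LinearMap.det (A : E →ₗ[ℝ] E) < 0)
    (o : VectorOrientation E) : transportOrientation A o = -o := if_neg hA.not_gt

/-- For an invertible map, this is the usual action on orientations. -/
theorem transportOrientation_eq_map [FiniteDimensional ℝ E] (A : E ≃L[ℝ] E)
    (o : VectorOrientation E) :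
    transportOrientation (A : E →L[ℝ] E) o = Orientation.map _ A.toLinearEquiv o := by
  have hd : LinearMap.det (((A : E →L[ℝ] E)) : E →ₗ[ℝ] E) ≠ 0 :=
    (LinearEquiv.isUnit_det' A.toLinearEquiv).ne_zero
  unfold transportOrientation
  split_ifs with h
  · exact ((Orientation.map_eq_iff_det_pos o A.toLinearEquiv (by simp)).2 h).symm
  · exact ((Orientation.map_eq_neg_iff_det_neg o A.toLinearEquiv (by simp)).2
      (lt_of_le_of_ne (not_lt.1 h) hd)).symm

theorem neg_one_units_smul (o : VectorOrientation E) : (-1 : ℤˣ) • o = -o := by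
  induction o using Module.Ray.ind with
  | h v hv =>
    rw [smul_rayOfNeZero, neg_rayOfNeZero]
    congr 1
    ext x
    simp [Units.smul_def]

theorem neg_units_smul (a : ℤˣ) (o : VectorOrientation E) : -(a • o) = a • -o := by
  rw [← neg_one_units_smul, ← neg_one_units_smul, smul_comm]

theorem existsUnique_units_smul [FiniteDimensional ℝ E] (o o' : VectorOrientation E) :
    ∃! a : ℤˣ, a • o = o' := by
  have hn : (-1 : ℤˣ) • o = -o := neg_one_units_smul o
  have hne : o ≠ -o := Module.Ray.ne_neg_self o
  rcases Orientation.eq_or_eq_neg o' o (by simp) with rfl | rfl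
  · refine ⟨1, one_smul _ _, fun a ha => ?_⟩
    rcases Int.units_eq_one_or a with rfl | rfl
    · rfl
    · exact absurd (ha.symm.trans hn) hne
  · refine ⟨-1, hn, fun a ha => ?_⟩
    rcases Int.units_eq_one_or a with rfl | rfl
    · exact absurd ((one_smul _ _).symm.trans ha) hne
    · rfl

theorem transportOrientation_units_smul (A : E →L[ℝ] E) (a : ℤˣ) (o : VectorOrientation E) :
    transportOrientation A (a • o) = a • transportOrientation A o := by
  unfold transportOrientation
  split_ifs <;> simp [neg_units_smul]

variable [FiniteDimensional ℝ E] {H : Type h} [TopologicalSpace H] (I : ModelWithCorners ℝ E H)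
  (M : Type u) [TopologicalSpace M] [ChartedSpace H M] [IsManifold I ∞ M]

/-- The Jacobian determinant of a change of charts does not vanish at the points where both charts
are defined. -/
theorem det_tangent_coordChange_ne_zero (i j : atlas H M) (x : M)
    (hx : x ∈ i.1.source ∩ j.1.source) :
    LinearMap.det (((tangentBundleCore I M).coordChange i j x : E →L[ℝ] E) : E →ₗ[ℝ] E) ≠ 0 := by
  have h1 : (((tangentBundleCore I M).coordChange j i x : E →L[ℝ] E) : E →ₗ[ℝ] E) ∘ₗ
      (((tangentBundleCore I M).coordChange i j x : E →L[ℝ] E) : E →ₗ[ℝ] E) = LinearMap.id := by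
    ext v
    have h2 := (tangentBundleCore I M).coordChange_comp i j i x ⟨hx, hx.1⟩ v
    rw [(tangentBundleCore I M).coordChange_self i x hx.1] at h2
    exact h2
  intro h0
  have h3 := congr_arg LinearMap.det h1
  rw [LinearMap.det_comp, h0, mul_zero, LinearMap.det_id] at h3
  exact zero_ne_one h3

/-- The bundle of orientations of the tangent spaces of `M`: it is described by the same charts as
the tangent bundle, the transition functions being the effect on orientations of the derivatives of
the coordinate changes of `M`. Its fibre over `x` is the set of orientations of
`TangentSpace I x = E`. -/
def orientationBundleCore : FiberBundleCore (atlas H M) M (VectorOrientation E) where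
  baseSet := (tangentBundleCore I M).baseSet
  isOpen_baseSet := (tangentBundleCore I M).isOpen_baseSet
  indexAt := (tangentBundleCore I M).indexAt
  mem_baseSet_at := (tangentBundleCore I M).mem_baseSet_at
  coordChange i j x := transportOrientation ((tangentBundleCore I M).coordChange i j x)
  coordChange_self i x hx o := by
    have h1 : (((tangentBundleCore I M).coordChange i i x : E →L[ℝ] E) : E →ₗ[ℝ] E) =
        LinearMap.id := by
      ext v
      exact (tangentBundleCore I M).coordChange_self i x hx v
    exact transportOrientation_of_pos (by rw [h1, LinearMap.det_id]; exact one_pos) o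
  continuousOn_coordChange i j := by
    have hd : ContinuousOn (fun x => LinearMap.det
        (((tangentBundleCore I M).coordChange i j x : E →L[ℝ] E) : E →ₗ[ℝ] E))
        ((tangentBundleCore I M).baseSet i ∩ (tangentBundleCore I M).baseSet j) :=
      ContinuousLinearMap.continuous_det.comp_continuousOn
        ((tangentBundleCore I M).continuousOn_coordChange i j)
    rintro ⟨x, o⟩ ⟨hx, -⟩
    have hne := det_tangent_coordChange_ne_zero I M i j x hx
    have hev : ∀ᶠ p : M × VectorOrientation E in
        nhdsWithin (x, o) (((tangentBundleCore I M).baseSet i ∩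
          (tangentBundleCore I M).baseSet j) ×ˢ Set.univ),
        transportOrientation ((tangentBundleCore I M).coordChange i j p.1) p.2 =
          transportOrientation ((tangentBundleCore I M).coordChange i j x) p.2 := by
      have hfst : Filter.Tendsto Prod.fst (nhdsWithin (x, o)
          (((tangentBundleCore I M).baseSet i ∩ (tangentBundleCore I M).baseSet j) ×ˢ Set.univ))
          (nhdsWithin x ((tangentBundleCore I M).baseSet i ∩
            (tangentBundleCore I M).baseSet j)) :=
        continuous_fst.continuousWithinAt.tendsto_nhdsWithin fun p hp => hp.1
      suffices hs : ∀ᶠ y in nhdsWithin x ((tangentBundleCore I M).baseSet i ∩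
          (tangentBundleCore I M).baseSet j), ∀ o' : VectorOrientation E,
          transportOrientation ((tangentBundleCore I M).coordChange i j y) o' =
            transportOrientation ((tangentBundleCore I M).coordChange i j x) o' from
        (hfst.eventually hs).mono fun p hp => hp p.2
      rcases lt_or_gt_of_ne hne with hneg | hpos
      · filter_upwards [(hd x hx).eventually_lt continuousWithinAt_const hneg] with y hy o'
        rw [transportOrientation_of_neg hy, transportOrientation_of_neg hneg]
      · filter_upwards [continuousWithinAt_const.eventually_lt (hd x hx) hpos] with y hy o'
        rw [transportOrientation_of_pos hy, transportOrientation_of_pos hpos]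
    refine ContinuousWithinAt.congr_of_eventuallyEq ?_ hev rfl
    exact ((continuous_of_discreteTopology
      (f := transportOrientation ((tangentBundleCore I M).coordChange i j x))).comp
        continuous_snd).continuousWithinAt
  coordChange_comp i j k x hx o := by
    have h1 : (((tangentBundleCore I M).coordChange j k x : E →L[ℝ] E) : E →ₗ[ℝ] E) ∘ₗ
        (((tangentBundleCore I M).coordChange i j x : E →L[ℝ] E) : E →ₗ[ℝ] E) =
        (((tangentBundleCore I M).coordChange i k x : E →L[ℝ] E) : E →ₗ[ℝ] E) := by
      ext v
      exact (tangentBundleCore I M).coordChange_comp i j k x hx v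
    have h2 := congr_arg LinearMap.det h1
    rw [LinearMap.det_comp] at h2
    have h3 := det_tangent_coordChange_ne_zero I M i j x hx.1
    have h4 := det_tangent_coordChange_ne_zero I M j k x ⟨hx.1.2, hx.2⟩
    rcases lt_or_gt_of_ne h3 with h3 | h3 <;> rcases lt_or_gt_of_ne h4 with h4 | h4
    · rw [transportOrientation_of_neg h3, transportOrientation_of_neg h4,
        transportOrientation_of_pos (h2 ▸ mul_pos_of_neg_of_neg h4 h3)]
      exact neg_neg (o : Module.Ray ℝ _)
    · rw [transportOrientation_of_neg h3, transportOrientation_of_pos h4,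
        transportOrientation_of_neg (h2 ▸ mul_neg_of_pos_of_neg h4 h3)]
    · rw [transportOrientation_of_pos h3, transportOrientation_of_neg h4,
        transportOrientation_of_neg (h2 ▸ mul_neg_of_neg_of_pos h4 h3)]
    · rw [transportOrientation_of_pos h3, transportOrientation_of_pos h4,
        transportOrientation_of_pos (h2 ▸ mul_pos h4 h3)]

/-- The total space of the orientation double cover of `M`: its points are the pairs `(x, o)` of a
point `x` of `M` and an orientation `o` of the tangent space at `x`. -/
abbrev OrientationTotal : Type (max u e) := (orientationBundleCore I M).TotalSpace

/-- The orientation `o` of the tangent space at `x`, as a point of the orientation double cover. -/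
def OrientationTotal.mk (x : M) (o : VectorOrientation E) : OrientationTotal I M := ⟨x, o⟩

variable {I M} in
/-- The orientation of the tangent space which underlies a point of the orientation double cover. -/
def OrientationTotal.orientation (p : OrientationTotal I M) : VectorOrientation E := p.2

/-- The group `{1, -1}` acts by reversing orientations. -/
instance : MulAction ℤˣᵐᵒᵖ (OrientationTotal I M) where
  smul a p := OrientationTotal.mk I M p.1 (unop a • p.orientation)
  one_smul p := congr_arg (OrientationTotal.mk I M p.1) (one_smul ℤˣ p.orientation)
  mul_smul a b p := congr_arg (OrientationTotal.mk I M p.1)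
    ((congr_arg (· • p.orientation) (mul_comm (unop b) (unop a))).trans
      (mul_smul (unop a) (unop b) p.orientation))

variable (E) in
/-- The standard orientation of `E` with respect to an arbitrary basis. -/
def someOrientation : VectorOrientation E := (Module.finBasis ℝ E).orientation

/-- The bijection `a ↦ a • o₀` between `{1, -1}` and the two orientations. -/
def unitsHomeomorphOrientation : ℤˣ ≃ₜ VectorOrientation E :=
  Equiv.toHomeomorphOfDiscrete
    (Equiv.ofBijective (fun a : ℤˣ => a • someOrientation E)
      (Function.bijective_iff_existsUnique _ |>.2 fun o =>
        existsUnique_units_smul (someOrientation E) o))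

theorem unitsHomeomorphOrientation_mul (a b : ℤˣ) :
    unitsHomeomorphOrientation (E := E) (a * b) = a • unitsHomeomorphOrientation b :=
  mul_smul a b (someOrientation E)

/-- The orientation double cover of `M`, a principal `{1, -1}`-bundle. -/
def orientationCover : PrincipalBundle.{max u e} ℤˣ M where
  Total := OrientationTotal I M
  proj := (orientationBundleCore I M).proj
  proj_smul p a := rfl
  locallyTrivial x := by
    refine ⟨((orientationBundleCore I M).localTrivAt x).transFiberHomeomorph
      unitsHomeomorphOrientation.symm, (orientationBundleCore I M).mem_localTrivAt_baseSet x, ?_⟩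
    intro p _ a
    rw [Trivialization.transFiberHomeomorph_apply, Trivialization.transFiberHomeomorph_apply]
    rw [← FiberBundleCore.localTrivAt_def, FiberBundleCore.localTriv_apply,
      FiberBundleCore.localTriv_apply]
    change unitsHomeomorphOrientation.symm
      (transportOrientation _ (a • OrientationTotal.orientation p)) =
      unitsHomeomorphOrientation.symm (transportOrientation _ (OrientationTotal.orientation p)) * a
    rw [transportOrientation_units_smul, Homeomorph.symm_apply_eq, mul_comm,
      unitsHomeomorphOrientation_mul, Homeomorph.apply_symm_apply]
    rfl

variable {M}

/-- The point of the orientation double cover over `m` given by the orientation `o`. -/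
def orientationPoint (m : M) (o : VectorOrientation E) : (orientationCover I M).proj ⁻¹' {m} :=
  ⟨OrientationTotal.mk I M m o, rfl⟩

/-- The orientation character `π₁(M, m) → {1, -1}`: the holonomy of the orientation double cover.
It does not depend on the choice of the orientation at `m`, see `smul_orientationCharacter`. -/
def orientationCharacter (m : M) : FundamentalGroup M m →* ℤˣ :=
  (orientationCover I M).holonomy (orientationPoint I m (someOrientation E))

/-- Transporting any orientation of the tangent space at `m` along the loop `γ` multiplies it by
the value of the orientation character on `γ`. -/
theorem smul_orientationCharacter (m : M) (γ : FundamentalGroup M m)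
    (p : (orientationCover I M).proj ⁻¹' {m}) :
    ((orientationCover I M).isCoveringMap.monodromy γ p).1 =
      p.1 <• orientationCharacter I m γ := by
  set q := orientationPoint I m (someOrientation E)
  obtain ⟨a, ha, _⟩ := (orientationCover I M).existsUnique_smul q.1 p.1 (q.2.trans p.2.symm)
  rw [PrincipalBundle.monodromy_smul _ q p a ha.symm,
    ← PrincipalBundle.smul_holonomyFun, ← ha, ← PrincipalBundle.smul_mul',
    ← PrincipalBundle.smul_mul', mul_comm]
  rfl

/-! ### The two groupoids -/

variable {Gh : Type v} [Group Gh] [TopologicalSpace Gh] [DiscreteTopology Gh] (π : Gh →* ℤˣ)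

variable (M) in
/-- The groupoid of orientation twisted principal bundles on `M`: the homotopy fibre of
`P ↦ P ×_π {1, -1}` over the orientation double cover. Its objects are the pairs `(P, ε)` of a
principal `Gh`-bundle `P` and an isomorphism `ε : P ×_π {1, -1} ⟶ or_M` of double covers. A morphism
`(P, ε) ⟶ (P', ε')` is a morphism `f : P ⟶ P'` with `ε' ∘ (f ×_π {1, -1}) = ε`. -/
abbrev OrientationTwistedBundle :=
  CostructuredArrow (PrincipalBundle.ind.{max u e} M π) (orientationCover I M)

/-- The homomorphisms `π₁(M, m) → Gh` whose composite with `π` is the orientation character. -/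
@[ext]
structure TwistedHom (m : M) where
  /-- The underlying homomorphism. -/
  hom : FundamentalGroup M m →* Gh
  comp_eq : π.comp hom = orientationCharacter I m

/-- The kernel of `π` acts by conjugation: `(g • ρ) γ = g * ρ γ * g⁻¹`. -/
instance (m : M) : MulAction π.ker (TwistedHom I π m) where
  smul g ρ :=
    { hom := (MulAut.conj (g : Gh)).toMonoidHom.comp ρ.hom
      comp_eq := by
        rw [← ρ.comp_eq]
        ext γ
        have hg : π g = 1 := g.2
        simp [hg] }
  one_smul ρ := TwistedHom.ext (MonoidHom.ext fun γ => congr($(map_one MulAut.conj) (ρ.hom γ)))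
  mul_smul g g' ρ := TwistedHom.ext (MonoidHom.ext fun γ =>
    congr($(map_mul MulAut.conj (g : Gh) (g' : Gh)) (ρ.hom γ)))

theorem TwistedHom.smul_apply (m : M) (g : π.ker) (ρ : TwistedHom I π m)
    (γ : FundamentalGroup M m) : (g • ρ).hom γ = g * ρ.hom γ * (g : Gh)⁻¹ := rfl

end Orientation

end

/-! ### Monodromy of covering maps -/

namespace IsCoveringMap

variable {X Y Z : Type*} [TopologicalSpace X] [TopologicalSpace Y] [TopologicalSpace Z]
  {p : Y → X} {p' : Z → X}

/-- Monodromy is computed by any lift of the path. -/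
theorem monodromy_mk_eq (cov : IsCoveringMap p) {x y : X} (δ : Path x y) (e : p ⁻¹' {x})
    (Γ : unitInterval → Y) (hΓ : Continuous Γ) (hp : ∀ s, p (Γ s) = δ s) (h0 : Γ 0 = e.1) :
    (cov.monodromy (.mk δ) e).1 = Γ 1 :=
  (congr_fun ((cov.eq_liftPath_iff (γ := δ.toContinuousMap) (e := e.1)
    (δ.source.trans e.2.symm)).2 ⟨hΓ, funext hp, h0⟩) 1).symm

/-- Every path has a lift that computes its monodromy. -/
theorem exists_lift_monodromy (cov : IsCoveringMap p) {x y : X} (δ : Path x y) (e : p ⁻¹' {x}) :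
    ∃ Γ : unitInterval → Y, Continuous Γ ∧ (∀ s, p (Γ s) = δ s) ∧ Γ 0 = e.1 ∧
      Γ 1 = (cov.monodromy (.mk δ) e).1 :=
  ⟨cov.liftPath δ.toContinuousMap e.1 (δ.source.trans e.2.symm), ContinuousMap.continuous _,
    fun s => congr_fun (cov.liftPath_lifts δ.toContinuousMap e.1 _) s,
    cov.liftPath_zero _ _ _, rfl⟩

/-- Continuous maps between covering spaces commute with monodromy. -/
theorem map_monodromy (cov : IsCoveringMap p) (cov' : IsCoveringMap p') {f : Y → Z}
    (hf : Continuous f) (hp : ∀ e, p' (f e) = p e) {x y : X}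
    (δ : Path.Homotopic.Quotient x y) (e : p ⁻¹' {x}) (e' : p' ⁻¹' {x}) (he : e'.1 = f e.1) :
    (cov'.monodromy δ e').1 = f (cov.monodromy δ e).1 := by
  obtain ⟨δ⟩ := δ
  obtain ⟨Γ, hΓ, hl, h0, h1⟩ := cov.exists_lift_monodromy δ e
  refine (cov'.monodromy_mk_eq δ e' (f ∘ Γ) (hf.comp hΓ) (fun s => ?_) ?_).trans ?_
  · exact (hp _).trans (hl s)
  · rw [he, ← h0]; rfl
  · exact congr_arg f h1

/-- Monodromy along a path in the base set of a trivialization is constant in the coordinates of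
this trivialization. -/
theorem trivialization_monodromy {F : Type*} [TopologicalSpace F] [DiscreteTopology F]
    (cov : IsCoveringMap p) (t : Trivialization F p) {x y : X} (δ : Path x y)
    (hδ : ∀ s, δ s ∈ t.baseSet) (e : p ⁻¹' {x}) :
    (t (cov.monodromy (.mk δ) e).1).2 = (t e.1).2 := by
  obtain ⟨Γ, hΓ, hl, h0, h1⟩ := cov.exists_lift_monodromy δ e
  have hc : Continuous fun s => (t (Γ s)).2 :=
    continuous_snd.comp (t.continuousOn_toFun.comp_continuous hΓ fun s =>
      t.mem_source.2 ((hl s).symm ▸ hδ s))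
  change (t (cov.monodromy (.mk δ) e).1).2 = _
  rw [← h0, ← h1]
  exact PreconnectedSpace.constant inferInstance hc

end IsCoveringMap

namespace PrincipalBundle

universe w w' u v v'

variable {G : Type v} [Group G] [TopologicalSpace G] [DiscreteTopology G]
  {K : Type v'} [Group K] [TopologicalSpace K] [DiscreteTopology K]
  {M : Type u} [TopologicalSpace M]

theorem monodromy_smul_path (P : PrincipalBundle.{w} G M) {x y : M} (p q : P.proj ⁻¹' {x}) (g : G)
    (hq : q.1 = p.1 <• g) (δ : Path.Homotopic.Quotient x y) :
    (P.isCoveringMap.monodromy δ q).1 = (P.isCoveringMap.monodromy δ p).1 <• g :=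
  P.isCoveringMap.map_monodromy P.isCoveringMap (P.continuous_smul' g)
    (fun e => P.proj_smul e g) δ p q hq

theorem exists_proj_eq (P : PrincipalBundle.{w} G M) (x : M) : ∃ p : P.Total, P.proj p = x := by
  obtain ⟨t, hx, -⟩ := P.locallyTrivial x
  exact ⟨t.toOpenPartialHomeomorph.symm (x, 1), t.proj_symm_apply' hx⟩

variable {m : M}

theorem smul_holonomy (P : PrincipalBundle.{w} G M) (p : P.proj ⁻¹' {m})
    (γ : FundamentalGroup M m) :
    p.1 <• P.holonomy p γ = (P.isCoveringMap.monodromy γ p).1 :=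
  P.smul_holonomyFun p γ

theorem holonomy_eq_of_smul (P : PrincipalBundle.{w} G M) (p : P.proj ⁻¹' {m})
    (γ : FundamentalGroup M m) (g : G) (h : p.1 <• g = (P.isCoveringMap.monodromy γ p).1) :
    P.holonomy p γ = g :=
  P.eq_of_smul_eq ((P.smul_holonomy p γ).trans h.symm)

theorem holonomy_smul (P : PrincipalBundle.{w} G M) (p q : P.proj ⁻¹' {m}) (g : G)
    (hq : q.1 = p.1 <• g) (γ : FundamentalGroup M m) :
    P.holonomy q γ = g⁻¹ * P.holonomy p γ * g := by
  apply P.holonomy_eq_of_smul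
  rw [P.monodromy_smul p q g hq, ← P.smul_holonomy, hq, ← P.smul_mul', ← P.smul_mul']
  group

/-- An equivariant map along `φ` composes holonomies with `φ`. -/
theorem holonomy_map (P : PrincipalBundle.{w} G M) (Q : PrincipalBundle.{w'} K M) (φ : G →* K)
    {f : P.Total → Q.Total} (hf : Continuous f) (hp : ∀ a, Q.proj (f a) = P.proj a)
    (hs : ∀ a g, f (a <• g) = f a <• φ g) (p : P.proj ⁻¹' {m}) (q : Q.proj ⁻¹' {m})
    (hq : q.1 = f p.1) : Q.holonomy q = φ.comp (P.holonomy p) := by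
  ext γ
  apply Q.holonomy_eq_of_smul
  rw [P.isCoveringMap.map_monodromy Q.isCoveringMap hf hp γ p q hq, ← P.smul_holonomy, hs, hq]
  rfl

theorem holonomy_hom {P Q : PrincipalBundle.{w} G M} (f : P ⟶ Q) (p : P.proj ⁻¹' {m})
    (q : Q.proj ⁻¹' {m}) (hq : q.1 = f.toFun p.1) : Q.holonomy q = P.holonomy p :=
  holonomy_map P Q (MonoidHom.id G) f.continuous_toFun f.proj_map f.map_smul p q hq

theorem holonomy_induced (φ : G →* K) (P : PrincipalBundle.{w} G M) (p : P.proj ⁻¹' {m})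
    (q : (induced φ P).proj ⁻¹' {m}) (hq : q.1 = inducedMk φ P (p.1, 1)) :
    (induced φ P).holonomy q = φ.comp (P.holonomy p) := by
  refine holonomy_map P (induced φ P) φ (f := fun a => inducedMk φ P (a, 1))
    ((isQuotientMap_inducedMk φ P).continuous.comp (by fun_prop)) (fun a => rfl)
    (fun a g => ?_) p q hq
  exact Quotient.sound ⟨g, rfl, by simp⟩

theorem exists_monodromy_smul [PathConnectedSpace M] (P : PrincipalBundle.{w} G M)
    (p : P.proj ⁻¹' {m}) (a : P.Total) :
    ∃ (α : Path.Homotopic.Quotient m (P.proj a)) (g : G),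
      (P.isCoveringMap.monodromy α p).1 <• g = a := by
  refine ⟨.mk (PathConnectedSpace.somePath _ _), ?_⟩
  exact (P.existsUnique_smul _ a (P.isCoveringMap.monodromy _ p).2).exists

/-- Morphisms of principal bundles on a path connected space are determined by their value at one
point. -/
theorem hom_ext_of_eq [PathConnectedSpace M] {P Q : PrincipalBundle.{w} G M} {f f' : P ⟶ Q}
    (p : P.Total) (h : f.toFun p = f'.toFun p) : f = f' := by
  refine hom_ext fun a => ?_
  obtain ⟨α, g, ha⟩ := P.exists_monodromy_smul ⟨p, rfl⟩ a
  rw [← ha, f.map_smul, f'.map_smul]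
  have h1 := P.isCoveringMap.map_monodromy Q.isCoveringMap f.continuous_toFun f.proj_map α
    ⟨p, rfl⟩ ⟨f.toFun p, f.proj_map p⟩ rfl
  have h2 := P.isCoveringMap.map_monodromy Q.isCoveringMap f'.continuous_toFun f'.proj_map α
    ⟨p, rfl⟩ ⟨f.toFun p, f.proj_map p⟩ h
  rw [← h1, ← h2]

/-- If two bundles have the same holonomy, a relation between lifts of two paths in one of them holds
in the other one. -/
theorem monodromy_smul_eq_of_holonomy_eq (P Q : PrincipalBundle.{w} G M) (p : P.proj ⁻¹' {m})
    (q : Q.proj ⁻¹' {m}) (h : P.holonomy p = Q.holonomy q) {x : M}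
    (α α' : Path.Homotopic.Quotient m x) (g g' : G)
    (hp : (P.isCoveringMap.monodromy α p).1 <• g = (P.isCoveringMap.monodromy α' p).1 <• g') :
    (Q.isCoveringMap.monodromy α q).1 <• g = (Q.isCoveringMap.monodromy α' q).1 <• g' := by
  let γ : FundamentalGroup M m := α.trans α'.symm
  have hα : α = Path.Homotopic.Quotient.trans γ α' := by
    simp [γ, Path.Homotopic.Quotient.trans_assoc]
  have key (R : PrincipalBundle.{w} G M) (r : R.proj ⁻¹' {m}) :
      (R.isCoveringMap.monodromy α r).1 = (R.isCoveringMap.monodromy α' r).1 <• R.holonomy r γ := by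
    rw [hα, R.isCoveringMap.monodromy_trans_apply]
    exact R.monodromy_smul_path r _ _ (R.smul_holonomy r γ).symm α'
  rw [key, ← smul_mul'] at hp
  rw [key, ← smul_mul', ← P.eq_of_smul_eq hp, h]

/-- An equivariant map over the base that commutes with monodromy is continuous. -/
theorem continuous_of_map_monodromy [LocallyPathConnectedSpace M] (P Q : PrincipalBundle.{w} G M)
    (f : P.Total → Q.Total) (hf : ∀ a, Q.proj (f a) = P.proj a)
    (hm : ∀ {x y : M} (δ : Path x y) (a : P.proj ⁻¹' {x}) (b : Q.proj ⁻¹' {x}), b.1 = f a.1 →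
      f (P.isCoveringMap.monodromy (.mk δ) a).1 = (Q.isCoveringMap.monodromy (.mk δ) b).1) :
    Continuous f := by
  rw [continuous_iff_continuousAt]
  intro a
  obtain ⟨t, ht, -⟩ := P.locallyTrivial (P.proj a)
  obtain ⟨t', ht', -⟩ := Q.locallyTrivial (P.proj a)
  obtain ⟨V, ⟨hV, hVc⟩, hVt⟩ := (path_connected_basis (P.proj a)).mem_iff.1
    (Filter.inter_mem (t.open_baseSet.mem_nhds ht) (t'.open_baseSet.mem_nhds ht'))
  have hproj : ContinuousAt (Q.proj ∘ f) a := by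
    rw [show Q.proj ∘ f = P.proj from funext hf]
    exact P.isCoveringMap.continuous.continuousAt
  refine t'.continuousAt_of_comp_left hproj (by rwa [hf]) ?_
  have hcoord : ∀ b, P.proj b ∈ V → (t' (f b)).2 =
      (t' (f (t.toOpenPartialHomeomorph.symm (P.proj a, (t b).2)))).2 := by
    intro b hb
    obtain ⟨δ, hδ⟩ := hVc.joinedIn _ hb _ (mem_of_mem_nhds hV)
    set c := P.isCoveringMap.monodromy (.mk δ) ⟨b, rfl⟩
    have h1 : c.1 = t.toOpenPartialHomeomorph.symm (P.proj a, (t b).2) := by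
      have h2 : (t c.1).2 = (t b).2 :=
        P.isCoveringMap.trivialization_monodromy t δ (fun s => (hVt (hδ s)).1) ⟨b, rfl⟩
      have h3 : P.proj c.1 = P.proj a := c.2
      have h4 : c.1 ∈ t.source := t.mem_source.2 (by rwa [h3])
      have h5 : (P.proj a, (t b).2) = t c.1 := Prod.ext (h3.symm.trans (t.coe_fst h4).symm) h2.symm
      rw [h5]
      exact (t.toOpenPartialHomeomorph.left_inv h4).symm
    rw [← h1, hm δ ⟨b, rfl⟩ ⟨f b, hf b⟩ rfl]
    exact (Q.isCoveringMap.trivialization_monodromy t' δ (fun s => (hVt (hδ s)).2)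
      ⟨f b, hf b⟩).symm
  have hVa : P.proj ⁻¹' V ∈ nhds a := P.isCoveringMap.continuous.continuousAt hV
  have hfst : ContinuousAt (fun b => (t' (f b)).1) a := by
    refine hproj.congr (Filter.eventually_of_mem hVa fun b hb => ?_)
    exact (t'.coe_fst (t'.mem_source.2 (by rw [hf]; exact (hVt hb).2))).symm
  have hsnd : ContinuousAt (fun b => (t' (f b)).2) a := by
    refine ContinuousAt.congr (f := fun b =>
      (t' (f (t.toOpenPartialHomeomorph.symm (P.proj a, (t b).2)))).2) ?_
      (Filter.eventually_of_mem hVa fun b hb => (hcoord b hb).symm)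
    refine ContinuousAt.comp (f := fun b => (t b).2) (g := fun g =>
      (t' (f (t.toOpenPartialHomeomorph.symm (P.proj a, g)))).2)
      continuous_of_discreteTopology.continuousAt ?_
    exact continuous_snd.continuousAt.comp
      (t.continuousOn_toFun.continuousAt (t.open_source.mem_nhds (t.mem_source.2 ht)))
  exact hfst.prodMk hsnd

/-- Principal bundles with the same holonomy are isomorphic, by an isomorphism that matches the
given points. -/
theorem exists_hom_of_holonomy_eq [PathConnectedSpace M] [LocallyPathConnectedSpace M]
    (P Q : PrincipalBundle.{w} G M) (p : P.proj ⁻¹' {m}) (q : Q.proj ⁻¹' {m})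
    (h : P.holonomy p = Q.holonomy q) : ∃ f : P ⟶ Q, f.toFun p.1 = q.1 := by
  choose α g hα using P.exists_monodromy_smul p
  let f : P.Total → Q.Total := fun a => (Q.isCoveringMap.monodromy (α a) q).1 <• g a
  have key : ∀ {x : M} (β : Path.Homotopic.Quotient m x) (k : G),
      f ((P.isCoveringMap.monodromy β p).1 <• k) = (Q.isCoveringMap.monodromy β q).1 <• k := by
    intro x β k
    obtain ⟨a, ha⟩ : ∃ a, (P.isCoveringMap.monodromy β p).1 <• k = a := ⟨_, rfl⟩
    obtain rfl : P.proj a = x := by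
      rw [← ha, P.proj_smul]; exact (P.isCoveringMap.monodromy β p).2
    rw [ha]
    exact P.monodromy_smul_eq_of_holonomy_eq Q p q h _ _ _ _ ((hα a).trans ha.symm)
  have hproj : ∀ a, Q.proj (f a) = P.proj a := fun a =>
    (Q.proj_smul _ _).trans (Q.isCoveringMap.monodromy (α a) q).2
  have hcont : Continuous f := by
    refine P.continuous_of_map_monodromy Q f hproj ?_
    rintro x y δ ⟨a, rfl⟩ b hb
    rw [Q.monodromy_smul_path (Q.isCoveringMap.monodromy (α a) q) b (g a) hb,
      P.monodromy_smul_path (P.isCoveringMap.monodromy (α a) p) ⟨a, rfl⟩ (g a) (hα a).symm,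
      ← Q.isCoveringMap.monodromy_trans_apply, ← P.isCoveringMap.monodromy_trans_apply]
    exact key _ _
  refine ⟨⟨f, hcont, fun a k => ?_, hproj⟩, ?_⟩
  · obtain ⟨h1, h2⟩ : (P.isCoveringMap.monodromy (α a) p).1 <• (g a * k) = a <• k ∧
        (Q.isCoveringMap.monodromy (α a) q).1 <• (g a * k) = f a <• k :=
      ⟨by rw [smul_mul', hα], by rw [smul_mul']⟩
    rw [← h1, ← h2]
    exact key _ _
  · have := key (Path.Homotopic.Quotient.refl m) 1
    rw [smul_one', smul_one', P.isCoveringMap.monodromy_refl, Q.isCoveringMap.monodromy_refl] at this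
    exact this

end PrincipalBundle

/-! ### Principal bundles with prescribed holonomy -/

/-- Every point has an open path connected neighbourhood in which any two paths with the same end
points are homotopic in the ambient space. -/
def HasSimplyConnectedNhds (M : Type*) [TopologicalSpace M] : Prop :=
  ∀ x : M, ∃ U : Set M, IsOpen U ∧ x ∈ U ∧ IsPathConnected U ∧
    ∀ ⦃y z : M⦄ (γ γ' : Path y z), (∀ s, γ s ∈ U) → (∀ s, γ' s ∈ U) → γ.Homotopic γ'

/-- An open neighbourhood of every point, with a class of paths from this point to every other
point which is compatible with paths inside the neighbourhood. -/
structure RadialPaths (M : Type*) [TopologicalSpace M] where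
  nhd : M → Set M
  isOpen_nhd : ∀ i, IsOpen (nhd i)
  mem_nhd : ∀ i, i ∈ nhd i
  path : ∀ i y : M, Path.Homotopic.Quotient i y
  path_self : ∀ i, path i i = .refl i
  path_trans : ∀ (i : M) {y z : M} (δ : Path y z), (∀ s, δ s ∈ nhd i) →
    (path i y).trans (.mk δ) = path i z

theorem HasSimplyConnectedNhds.nonempty_radialPaths {M : Type*} [TopologicalSpace M]
    [PathConnectedSpace M] (h : HasSimplyConnectedNhds M) : Nonempty (RadialPaths M) := by
  choose U hU hx hc hs using h
  have h1 : ∀ i y : M, ∃ q : Path.Homotopic.Quotient i y,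
      ∀ δ : Path i y, (∀ s, δ s ∈ U i) → q = .mk δ := by
    intro i y
    by_cases hy : y ∈ U i
    · obtain ⟨δ, hδ⟩ := (hc i).joinedIn i (hx i) y hy
      exact ⟨.mk δ, fun δ' hδ' => Path.Homotopic.Quotient.eq.2 (hs i δ δ' hδ hδ')⟩
    · exact ⟨.mk (PathConnectedSpace.somePath i y),
        fun δ hδ => absurd (δ.target ▸ hδ 1) hy⟩
  choose q hq using h1
  refine ⟨⟨U, hU, hx, q, fun i => hq i i (Path.refl i) fun s => hx i, fun i y z δ hδ => ?_⟩⟩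
  obtain ⟨δ', hδ'⟩ := (hc i).joinedIn i (hx i) y (δ.source ▸ hδ 0)
  rw [hq i y δ' hδ', ← Path.Homotopic.Quotient.mk_trans]
  refine (hq i z _ fun s => ?_).symm
  rw [Path.trans_apply]
  split_ifs
  exacts [hδ' _, hδ _]

/-- A functor from the fundamental groupoid of `M` to the group `G`. -/
structure PathTransport (M : Type*) [TopologicalSpace M] (G : Type*) [Group G] where
  toFun : ∀ {x y : M}, Path.Homotopic.Quotient x y → G
  map_trans : ∀ {x y z : M} (δ : Path.Homotopic.Quotient x y) (δ' : Path.Homotopic.Quotient y z),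
    toFun (δ.trans δ') = toFun δ' * toFun δ

namespace PathTransport

universe w u v

variable {M : Type u} [TopologicalSpace M] {G : Type v} [Group G]

instance : CoeFun (PathTransport M G)
    fun _ => ∀ {x y : M}, Path.Homotopic.Quotient x y → G := ⟨toFun⟩

theorem map_refl (T : PathTransport M G) (x : M) : T (.refl x) = 1 := by
  have h := T.map_trans (.refl x) (.refl x)
  rwa [Path.Homotopic.Quotient.refl_trans, left_eq_mul] at h

theorem map_cast (T : PathTransport M G) {x y x' y' : M} (δ : Path.Homotopic.Quotient x y)
    (hx : x' = x) (hy : y' = y) : T (δ.cast hx hy) = T δ := by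
  subst hx hy
  rw [Path.Homotopic.Quotient.cast_rfl_rfl]

/-- The transport defined by a representation of the fundamental group and a choice of paths from
the base point. -/
noncomputable def ofHom {m : M} (ρ : FundamentalGroup M m →* G) (α : ∀ x, Path.Homotopic.Quotient m x) :
    PathTransport M G where
  toFun {x y} δ := ρ (((α x).trans δ).trans (α y).symm)
  map_trans {x y z} δ δ' := by
    rw [← ρ.map_mul, FundamentalGroup.mul_def]
    congr 1
    simp only [Path.Homotopic.Quotient.trans_assoc]
    rw [← Path.Homotopic.Quotient.trans_assoc (α y).symm, Path.Homotopic.Quotient.symm_trans,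
      Path.Homotopic.Quotient.refl_trans]

theorem ofHom_loop {m : M} (ρ : FundamentalGroup M m →* G)
    (α : ∀ x, Path.Homotopic.Quotient m x) (γ : FundamentalGroup M m) :
    ofHom ρ α γ = (ρ (α m))⁻¹ * ρ γ * ρ (α m) := by
  rw [← map_inv, ← map_mul, ← map_mul, FundamentalGroup.mul_def, FundamentalGroup.mul_def,
    FundamentalGroup.inv_def]
  exact congr_arg ρ (Path.Homotopic.Quotient.trans_assoc _ _ _)

variable [TopologicalSpace G] [DiscreteTopology G] [LocallyPathConnectedSpace M]
  (T : PathTransport M G) (R : RadialPaths M)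
  {F : Type w} [TopologicalSpace F] [DiscreteTopology F] (σ : F ≃ G)

/-- The fibre bundle whose parallel transport is `T`. -/
noncomputable def bundleCore : FiberBundleCore M M F where
  baseSet := R.nhd
  isOpen_baseSet := R.isOpen_nhd
  indexAt := id
  mem_baseSet_at := R.mem_nhd
  coordChange i j y f := σ.symm ((T (R.path j y))⁻¹ * T (R.path i y) * σ f)
  coordChange_self i y _ f := by simp
  coordChange_comp i j k y _ f := by simp [mul_assoc]
  continuousOn_coordChange i j := by
    rintro ⟨x, f⟩ ⟨hx, -⟩
    refine ContinuousAt.continuousWithinAt ?_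
    obtain ⟨V, ⟨hV, hVc⟩, hVU⟩ := (path_connected_basis x).mem_iff.1
      (((R.isOpen_nhd i).inter (R.isOpen_nhd j)).mem_nhds hx)
    refine ContinuousAt.congr (f := fun p : M × F =>
      σ.symm ((T (R.path j x))⁻¹ * T (R.path i x) * σ p.2))
      ((continuous_of_discreteTopology (f := fun f : F =>
        σ.symm ((T (R.path j x))⁻¹ * T (R.path i x) * σ f))).comp continuous_snd).continuousAt ?_
    refine Filter.eventually_of_mem (continuous_fst.continuousAt hV) ?_
    rintro ⟨y, g⟩ hy
    obtain ⟨δ, hδ⟩ := hVc.joinedIn x (mem_of_mem_nhds hV) y hy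
    simp only
    rw [← R.path_trans i δ fun s => (hVU (hδ s)).1, ← R.path_trans j δ fun s => (hVU (hδ s)).2,
      T.map_trans, T.map_trans]
    simp [mul_assoc]

/-- The principal bundle whose parallel transport is `T`. -/
noncomputable def bundle : PrincipalBundle.{max u w} G M where
  Total := (T.bundleCore R σ).TotalSpace
  action :=
    { smul := fun g p => ⟨p.1, σ.symm (σ p.2 * unop g)⟩
      one_smul := fun p => by
        have h (f : F) : σ.symm (σ f * 1) = f := by simp
        exact congr_arg (TotalSpace.mk p.1) (h p.2)
      mul_smul := fun g g' p => by
        have h (f : F) : σ.symm (σ f * (unop g' * unop g)) =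
            σ.symm (σ (σ.symm (σ f * unop g')) * unop g) := by simp [mul_assoc]
        exact congr_arg (TotalSpace.mk p.1) (h p.2) }
  proj := (T.bundleCore R σ).proj
  proj_smul p g := rfl
  locallyTrivial x := by
    refine ⟨((T.bundleCore R σ).localTrivAt x).transFiberHomeomorph
      (Equiv.toHomeomorphOfDiscrete σ), (T.bundleCore R σ).mem_localTrivAt_baseSet x, ?_⟩
    intro p _ g
    change σ (σ.symm ((T (R.path x p.1))⁻¹ * T (R.path p.1 p.1) * σ (σ.symm (σ p.2 * g)))) =
      σ (σ.symm ((T (R.path x p.1))⁻¹ * T (R.path p.1 p.1) * σ p.2)) * g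
    simp only [σ.apply_symm_apply, mul_assoc]

/-- The point of the bundle over `x` with coordinate `f`. -/
noncomputable def bundlePoint (x : M) (f : F) : (T.bundle R σ).proj ⁻¹' {x} := ⟨⟨x, f⟩, rfl⟩

theorem eventually_subpath_mem {x y : M} (δ : Path x y) {U : Set M} (hU : IsOpen U)
    (s₀ : unitInterval) (h : δ s₀ ∈ U) : ∀ᶠ s in nhds s₀, ∀ r, δ.subpath s₀ s r ∈ U := by
  obtain ⟨b, c, hs, hn, hbc⟩ := exists_Icc_mem_subset_of_mem_nhds
    (δ.continuous.continuousAt.preimage_mem_nhds (hU.mem_nhds h))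
  filter_upwards [hn] with s hs' r
  have hr : δ.subpath s₀ s r ∈ Set.range (δ.subpath s₀ s) := ⟨r, rfl⟩
  rw [Path.range_subpath] at hr
  obtain ⟨t, ht, htr⟩ := hr
  rw [← htr]
  exact hbc (Set.ordConnected_Icc.uIcc_subset hs hs' ht)

theorem map_subpath_trans {x y : M} (δ : Path x y) (a b c : unitInterval) :
    T (.mk (δ.subpath a c)) = T (.mk (δ.subpath b c)) * T (.mk (δ.subpath a b)) := by
  rw [← T.map_trans, ← Path.Homotopic.Quotient.mk_trans]
  exact congr_arg _ (Path.Homotopic.Quotient.eq.2 ⟨Path.Homotopy.subpathTransSubpath δ a b c⟩).symm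

theorem monodromy_bundlePoint {x y : M} (δ : Path.Homotopic.Quotient x y) (f : F) :
    (T.bundle R σ).isCoveringMap.monodromy δ (T.bundlePoint R σ x f) =
      T.bundlePoint R σ y (σ.symm (T δ * σ f)) := by
  obtain ⟨δ⟩ := δ
  let Γ : unitInterval → (T.bundle R σ).Total := fun s =>
    (T.bundlePoint R σ (δ s) (σ.symm (T (.mk (δ.subpath 0 s)) * σ f))).1
  have hΓ : Continuous Γ := by
    rw [continuous_iff_continuousAt]
    intro s₀
    refine ((T.bundleCore R σ).localTrivAt (δ s₀)).continuousAt_of_comp_left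
      δ.continuous.continuousAt ((T.bundleCore R σ).mem_localTrivAt_baseSet _) ?_
    refine ContinuousAt.congr (f := fun s => (δ s, σ.symm (T (.mk (δ.subpath 0 s₀)) * σ f)))
      (δ.continuous.continuousAt.prodMk continuousAt_const) ?_
    filter_upwards [eventually_subpath_mem δ (R.isOpen_nhd (δ s₀)) s₀ (R.mem_nhd _)] with s hs
    refine Prod.ext rfl ?_
    change _ = σ.symm ((T (R.path (δ s₀) (δ s)))⁻¹ * T (R.path (δ s) (δ s)) *
      σ (σ.symm (T (.mk (δ.subpath 0 s)) * σ f)))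
    rw [← R.path_trans (δ s₀) (δ.subpath s₀ s) hs, R.path_self, R.path_self,
      Path.Homotopic.Quotient.refl_trans, T.map_refl, T.map_subpath_trans δ 0 s₀ s,
      σ.apply_symm_apply]
    group
  have hpt : ∀ {a b : M} (_ : a = b) (g : F),
      (T.bundlePoint R σ a g).1 = (T.bundlePoint R σ b g).1 := by
    rintro a _ rfl g; rfl
  refine Subtype.ext (((T.bundle R σ).isCoveringMap.monodromy_mk_eq δ _ Γ hΓ
    (fun s => rfl) ?_).trans ?_)
  · change (T.bundlePoint R σ (δ 0) (σ.symm (T (.mk (δ.subpath 0 0)) * σ f))).1 = _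
    rw [Path.subpath_self, Path.Homotopic.Quotient.mk_refl, T.map_refl, one_mul,
      σ.symm_apply_apply]
    exact hpt δ.source f
  · change (T.bundlePoint R σ (δ 1) (σ.symm (T (.mk (δ.subpath 0 1)) * σ f))).1 = _
    rw [Path.subpath_zero_one, Path.Homotopic.Quotient.mk_cast, T.map_cast]
    exact hpt δ.target _

end PathTransport

/-- Every representation of the fundamental group is the holonomy of a principal bundle. The total
space can be taken in every universe that contains the base and a copy of the group. -/
theorem PrincipalBundle.exists_holonomy_eq.{w, u, v} {M : Type u} [TopologicalSpace M]
    [PathConnectedSpace M] [LocallyPathConnectedSpace M] (hM : HasSimplyConnectedNhds M)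
    {G : Type v} [Group G] [TopologicalSpace G] [DiscreteTopology G] [Small.{w} G] {m : M}
    (ρ : FundamentalGroup M m →* G) :
    ∃ (P : PrincipalBundle.{max u w} G M) (p : P.proj ⁻¹' {m}), P.holonomy p = ρ := by
  obtain ⟨R⟩ := hM.nonempty_radialPaths
  let _ : TopologicalSpace (Shrink.{w} G) := ⊥
  have _ : DiscreteTopology (Shrink.{w} G) := ⟨rfl⟩
  let σ : Shrink.{w} G ≃ G := (equivShrink G).symm
  let α : ∀ x, Path.Homotopic.Quotient m x := fun x => .mk (PathConnectedSpace.somePath m x)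
  let T := PathTransport.ofHom ρ α
  refine ⟨T.bundle R σ, T.bundlePoint R σ m (σ.symm (ρ (α m))⁻¹), MonoidHom.ext fun γ => ?_⟩
  apply PrincipalBundle.holonomy_eq_of_smul
  rw [T.monodromy_bundlePoint]
  refine congr_arg (TotalSpace.mk m) (congr_arg σ.symm ?_)
  change σ (σ.symm (ρ (α m))⁻¹) * ρ γ = T γ * _
  rw [PathTransport.ofHom_loop, σ.apply_symm_apply]
  simp

/-! ### Local topology of manifolds -/

namespace ModelWithCorners

variable {E : Type*} [NormedAddCommGroup E] [NormedSpace ℝ E] {H : Type*} [TopologicalSpace H]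

theorem locallyPathConnectedSpace (I : ModelWithCorners ℝ E H) : LocallyPathConnectedSpace H := by
  have := I.convex_range.locallyPathConnectedSpace
  exact I.isClosedEmbedding.isEmbedding.toHomeomorph.isOpenEmbedding.locallyPathConnectedSpace

theorem hasSimplyConnectedNhds (I : ModelWithCorners ℝ E H) (M : Type*) [TopologicalSpace M]
    [ChartedSpace H M] : HasSimplyConnectedNhds M := by
  intro x
  set φ := chartAt H x
  have hx : x ∈ φ.source := mem_chart_source H x
  obtain ⟨ε, hε, hb⟩ := Metric.mem_nhds_iff.1
    ((φ.open_target.preimage I.continuous_symm).mem_nhds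
      (x := I (φ x)) (by simpa using φ.map_source hx))
  let C : Set E := Set.range I ∩ Metric.ball (I (φ x)) ε
  have hC : Convex ℝ C := I.convex_range.inter (convex_ball _ _)
  have hxC : I (φ x) ∈ C := ⟨⟨_, rfl⟩, Metric.mem_ball_self hε⟩
  have := hC.contractibleSpace ⟨_, hxC⟩
  let U : Set M := φ.source ∩ φ ⁻¹' (I ⁻¹' Metric.ball (I (φ x)) ε)
  let g : C(C, M) := ⟨fun c => φ.symm (I.symm c.1),
    φ.continuousOn_symm.comp_continuous (I.continuous_symm.comp continuous_subtype_val)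
      fun c => hb c.2.2⟩
  have hf : ∀ y ∈ U, I (φ y) ∈ C := fun y hy => ⟨⟨_, rfl⟩, hy.2⟩
  have hgf : ∀ (y : M) (hy : y ∈ U), y = g ⟨I (φ y), hf y hy⟩ := fun y hy => by
    simp [g, φ.left_inv hy.1]
  have hgU : Set.range g = U := by
    refine Set.Subset.antisymm ?_ fun y hy => ⟨_, (hgf y hy).symm⟩
    rintro _ ⟨⟨_, ⟨h, rfl⟩, hc⟩, rfl⟩
    have hh : h ∈ φ.target := by simpa using hb hc
    refine ⟨by simpa [g] using φ.map_target hh, ?_⟩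
    simpa [g, φ.right_inv hh] using hc
  refine ⟨U, φ.isOpen_inter_preimage (Metric.isOpen_ball.preimage I.continuous),
    ⟨hx, Metric.mem_ball_self hε⟩, hgU ▸ isPathConnected_range g.continuous, ?_⟩
  intro y z γ γ' hγ hγ'
  have hy : y ∈ U := γ.source ▸ hγ 0
  have hz : z ∈ U := γ.target ▸ hγ 1
  have lift : ∀ δ : Path y z, (∀ s, δ s ∈ U) →
      ∃ δ' : Path (X := C) ⟨I (φ y), hf y hy⟩ ⟨I (φ z), hf z hz⟩,
        δ = (δ'.map g.continuous).cast (hgf y hy) (hgf z hz) := by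
    intro δ hδ
    refine ⟨⟨⟨fun s => ⟨I (φ (δ s)), hf _ (hδ s)⟩, ?_⟩, ?_, ?_⟩, ?_⟩
    · exact (I.continuous.comp (φ.continuousOn.comp_continuous δ.continuous
        fun s => (hδ s).1)).subtype_mk _
    · simp
    · simp
    · ext s
      exact hgf _ (hδ s)
  obtain ⟨δ, rfl⟩ := lift γ hγ
  obtain ⟨δ', rfl⟩ := lift γ' hγ'
  rw [← Path.Homotopic.Quotient.eq, Path.Homotopic.Quotient.mk_cast,
    Path.Homotopic.Quotient.mk_cast,
    Path.Homotopic.Quotient.eq.2 ((SimplyConnectedSpace.paths_homotopic δ δ').map g)]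

end ModelWithCorners

/-! ### The holonomy functor -/

namespace OrientationTwistedBundle

universe u v e h

variable {E : Type e} [NormedAddCommGroup E] [NormedSpace ℝ E] [FiniteDimensional ℝ E]
  {H : Type h} [TopologicalSpace H] {I : ModelWithCorners ℝ E H}
  {M : Type u} [TopologicalSpace M] [ChartedSpace H M] [IsManifold I ∞ M]
  {Gh : Type v} [Group Gh] [TopologicalSpace Gh] [DiscreteTopology Gh] {π : Gh →* ℤˣ}

/-- A point over `m` is adapted if the isomorphism with the orientation double cover maps it to the
standard orientation of the tangent space at `m`. -/
def IsAdapted (X : OrientationTwistedBundle I M π) {m : M} (p : X.left.proj ⁻¹' {m}) : Prop :=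
  X.hom.toFun (PrincipalBundle.inducedMk π X.left (p.1, 1)) =
    (orientationPoint I m (someOrientation E)).1

theorem hom_inducedMk_smul (X : OrientationTwistedBundle I M π) (p : X.left.Total) (g : Gh) :
    X.hom.toFun (PrincipalBundle.inducedMk π X.left (p <• g, 1)) =
      X.hom.toFun (PrincipalBundle.inducedMk π X.left (p, 1)) <• π g := by
  have h : PrincipalBundle.inducedMk π X.left (p <• g, 1) =
      PrincipalBundle.inducedMk π X.left (p, 1) <• π g :=
    Quotient.sound ⟨g, rfl, by simp⟩
  rw [h]
  exact X.hom.map_smul _ _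

theorem exists_isAdapted (hπ : Function.Surjective π) (X : OrientationTwistedBundle I M π)
    (m : M) : ∃ p : X.left.proj ⁻¹' {m}, IsAdapted X p := by
  obtain ⟨p, hp⟩ := X.left.exists_proj_eq m
  obtain ⟨a, ha, -⟩ := (orientationCover I M).existsUnique_smul
    (X.hom.toFun (PrincipalBundle.inducedMk π X.left (p, 1)))
    (orientationPoint I m (someOrientation E)).1
    ((X.hom.proj_map _).trans (hp.trans (orientationPoint I m (someOrientation E)).2.symm))
  obtain ⟨g, rfl⟩ := hπ a
  exact ⟨⟨p <• g, (X.left.proj_smul p g).trans hp⟩, (hom_inducedMk_smul X p g).trans ha⟩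

theorem IsAdapted.comp_holonomy {X : OrientationTwistedBundle I M π} {m : M}
    {p : X.left.proj ⁻¹' {m}} (hp : IsAdapted X p) :
    π.comp (X.left.holonomy p) = orientationCharacter I m := by
  rw [← PrincipalBundle.holonomy_induced π X.left p
    ⟨PrincipalBundle.inducedMk π X.left (p.1, 1), p.2⟩ rfl]
  exact (PrincipalBundle.holonomy_hom X.hom _ _ hp.symm).symm

theorem hom_left_comp {X Y : OrientationTwistedBundle I M π} (f : X ⟶ Y) (p : X.left.Total) :
    Y.hom.toFun (PrincipalBundle.inducedMk π Y.left (f.left.toFun p, 1)) =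
      X.hom.toFun (PrincipalBundle.inducedMk π X.left (p, 1)) :=
  congr_fun (congr_arg PrincipalBundle.Hom.toFun (CostructuredArrow.w f))
    (PrincipalBundle.inducedMk π X.left (p, 1))

theorem IsAdapted.map {X Y : OrientationTwistedBundle I M π} {m : M} {p : X.left.proj ⁻¹' {m}}
    (hp : IsAdapted X p) (f : X ⟶ Y) :
    IsAdapted Y ⟨f.left.toFun p.1, (f.left.proj_map p.1).trans p.2⟩ :=
  (hom_left_comp f p.1).trans hp

theorem IsAdapted.map_eq_one {X : OrientationTwistedBundle I M π} {m : M}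
    {p q : X.left.proj ⁻¹' {m}} (hp : IsAdapted X p) (hq : IsAdapted X q) {g : Gh}
    (hg : p.1 <• g = q.1) : π g = 1 := by
  have h1 := hom_inducedMk_smul X p.1 g
  unfold IsAdapted at hp hq
  rw [hg, hp, hq] at h1
  refine (orientationCover I M).eq_of_smul_eq (h1.symm.trans ?_)
  exact ((orientationCover I M).smul_one' _).symm

theorem IsAdapted.smul {X : OrientationTwistedBundle I M π} {m : M}
    {p q : X.left.proj ⁻¹' {m}} (hp : IsAdapted X p) {g : Gh} (hg : π g = 1)
    (hq : q.1 = p.1 <• g) : IsAdapted X q := by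
  have h1 := hom_inducedMk_smul X p.1 g
  rw [hg, PrincipalBundle.smul_one', ← hq] at h1
  exact h1.trans hp

variable (hπ : Function.Surjective π) (m : M)

/-- A chosen adapted point over `m`. -/
noncomputable def basePoint (X : OrientationTwistedBundle I M π) : X.left.proj ⁻¹' {m} :=
  (exists_isAdapted hπ X m).choose

theorem isAdapted_basePoint (X : OrientationTwistedBundle I M π) :
    IsAdapted X (basePoint hπ m X) :=
  (exists_isAdapted hπ X m).choose_spec

theorem existsUnique_basePoint_smul {X Y : OrientationTwistedBundle I M π} (f : X ⟶ Y) :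
    ∃! g : Gh, (basePoint hπ m Y).1 <• g = f.left.toFun (basePoint hπ m X).1 :=
  Y.left.existsUnique_smul _ _ ((basePoint hπ m Y).2.trans
    ((f.left.proj_map _).trans (basePoint hπ m X).2).symm)

/-- The difference between the chosen point of `Y` and the image under `f` of the chosen point of
`X`. -/
noncomputable def homLabel {X Y : OrientationTwistedBundle I M π} (f : X ⟶ Y) : π.ker :=
  ⟨(existsUnique_basePoint_smul hπ m f).choose,
    (isAdapted_basePoint hπ m Y).map_eq_one ((isAdapted_basePoint hπ m X).map f)
      (existsUnique_basePoint_smul hπ m f).choose_spec.1⟩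

theorem smul_homLabel {X Y : OrientationTwistedBundle I M π} (f : X ⟶ Y) :
    (basePoint hπ m Y).1 <• (homLabel hπ m f : Gh) = f.left.toFun (basePoint hπ m X).1 :=
  (existsUnique_basePoint_smul hπ m f).choose_spec.1

theorem homLabel_eq {X Y : OrientationTwistedBundle I M π} (f : X ⟶ Y) (g : π.ker)
    (h : (basePoint hπ m Y).1 <• (g : Gh) = f.left.toFun (basePoint hπ m X).1) :
    homLabel hπ m f = g :=
  Subtype.ext (Y.left.eq_of_smul_eq ((smul_homLabel hπ m f).trans h.symm))

/-- The holonomy of an orientation twisted bundle with respect to the chosen point. -/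
noncomputable def twistedHolonomy (X : OrientationTwistedBundle I M π) : TwistedHom I π m :=
  ⟨X.left.holonomy (basePoint hπ m X), (isAdapted_basePoint hπ m X).comp_holonomy⟩

theorem homLabel_smul_twistedHolonomy {X Y : OrientationTwistedBundle I M π} (f : X ⟶ Y) :
    homLabel hπ m f • twistedHolonomy hπ m X = twistedHolonomy hπ m Y := by
  refine TwistedHom.ext (MonoidHom.ext fun γ => ?_)
  rw [TwistedHom.smul_apply]
  let q : Y.left.proj ⁻¹' {m} :=
    ⟨f.left.toFun (basePoint hπ m X).1, (f.left.proj_map _).trans (basePoint hπ m X).2⟩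
  have h1 : Y.left.holonomy q = X.left.holonomy (basePoint hπ m X) :=
    PrincipalBundle.holonomy_hom f.left _ q rfl
  have h2 := Y.left.holonomy_smul (basePoint hπ m Y) q _ (smul_homLabel hπ m f).symm γ
  change _ * X.left.holonomy (basePoint hπ m X) γ * _ = Y.left.holonomy (basePoint hπ m Y) γ
  rw [← h1, h2]
  group

/-- The functor that sends an orientation twisted bundle to its holonomy. -/
noncomputable def holonomyFunctor :
    OrientationTwistedBundle I M π ⥤ ActionCategory π.ker (TwistedHom I π m) where
  obj X := ActionCategory.objEquiv _ _ (twistedHolonomy hπ m X)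
  map f := ⟨homLabel hπ m f, homLabel_smul_twistedHolonomy hπ m f⟩
  map_id X := Subtype.ext (homLabel_eq hπ m _ _ (X.left.smul_one' _))
  map_comp {X Y Z} f g := Subtype.ext (homLabel_eq hπ m _ _ (by
    change (basePoint hπ m Z).1 <• ((homLabel hπ m g : Gh) * (homLabel hπ m f : Gh)) =
      g.left.toFun (f.left.toFun (basePoint hπ m X).1)
    rw [Z.left.smul_mul', smul_homLabel, ← smul_homLabel hπ m f, g.left.map_smul]))

theorem faithful_holonomyFunctor [PathConnectedSpace M] :
    (holonomyFunctor (I := I) hπ m).Faithful where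
  map_injective {X Y} f f' hf := by
    have h : homLabel hπ m f = homLabel hπ m f' := congr_arg Subtype.val hf
    refine CostructuredArrow.hom_ext _ _
      (PrincipalBundle.hom_ext_of_eq (basePoint hπ m X).1 ?_)
    rw [← smul_homLabel, ← smul_homLabel, h]

theorem full_holonomyFunctor [PathConnectedSpace M] [LocallyPathConnectedSpace M] :
    (holonomyFunctor (I := I) hπ m).Full where
  map_surjective {X Y} k := by
    let g : π.ker := k.1
    have hg' : g • twistedHolonomy hπ m X = twistedHolonomy hπ m Y := k.2
    let q : Y.left.proj ⁻¹' {m} := ⟨(basePoint hπ m Y).1 <• (g : Gh),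
      (Y.left.proj_smul _ _).trans (basePoint hπ m Y).2⟩
    have hq : IsAdapted Y q := (isAdapted_basePoint hπ m Y).smul g.2 rfl
    obtain ⟨f, hf⟩ := PrincipalBundle.exists_hom_of_holonomy_eq X.left Y.left
      (basePoint hπ m X) q (MonoidHom.ext fun γ => by
        rw [Y.left.holonomy_smul (basePoint hπ m Y) q g rfl γ]
        have h1 : (g : Gh) * X.left.holonomy (basePoint hπ m X) γ * (g : Gh)⁻¹ =
            Y.left.holonomy (basePoint hπ m Y) γ := congr(($hg').hom γ)
        rw [← h1]
        group)
    have hw : (PrincipalBundle.ind M π).map f ≫ Y.hom = X.hom := by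
      refine PrincipalBundle.hom_ext_of_eq
        (PrincipalBundle.inducedMk π X.left ((basePoint hπ m X).1, 1)) ?_
      refine Eq.trans ?_ (isAdapted_basePoint hπ m X).symm
      refine Eq.trans ?_ hq
      exact congr_arg (fun a => Y.hom.toFun (PrincipalBundle.inducedMk π Y.left (a, 1))) hf
    exact ⟨CostructuredArrow.homMk f hw, Subtype.ext (homLabel_eq hπ m _ g hf.symm)⟩

theorem essSurj_holonomyFunctor [PathConnectedSpace M] [LocallyPathConnectedSpace M]
    (hM : HasSimplyConnectedNhds M) [Small.{max u e} Gh] :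
    (holonomyFunctor (I := I) hπ m).EssSurj where
  mem_essImage Y := by
    obtain ⟨ρ, rfl⟩ := (ActionCategory.objEquiv _ _).surjective Y
    obtain ⟨P, p, hP⟩ : ∃ (P : PrincipalBundle.{max u e} Gh M) (p : P.proj ⁻¹' {m}),
      P.holonomy p = ρ.hom := PrincipalBundle.exists_holonomy_eq.{max u e} hM ρ.hom
    obtain ⟨ε, hε⟩ := PrincipalBundle.exists_hom_of_holonomy_eq
      (PrincipalBundle.induced π P) (orientationCover I M)
      (⟨PrincipalBundle.inducedMk π P (p.1, 1), p.2⟩ : _ ⁻¹' {m})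
      (orientationPoint I m (someOrientation E))
      ((PrincipalBundle.holonomy_induced π P p _ rfl).trans (by rw [hP, ρ.comp_eq]; rfl))
    let X : OrientationTwistedBundle I M π :=
      CostructuredArrow.mk (S := PrincipalBundle.ind M π) (Y := P) ε
    have hp : IsAdapted X p := hε
    obtain ⟨g, hg, -⟩ := P.existsUnique_smul p.1 (basePoint hπ m X).1
      (p.2.trans (basePoint hπ m X).2.symm)
    have hg1 : π g = 1 := hp.map_eq_one (isAdapted_basePoint hπ m X) hg
    let k : π.ker := ⟨g, hg1⟩
    have hk : k • twistedHolonomy hπ m X = ρ := by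
      refine TwistedHom.ext (MonoidHom.ext fun γ => ?_)
      rw [TwistedHom.smul_apply, ← hP]
      have h1 := P.holonomy_smul p (basePoint hπ m X) g hg.symm γ
      change g * P.holonomy (basePoint hπ m X) γ * g⁻¹ = _
      rw [h1]
      group
    let i : (holonomyFunctor hπ m).obj X ⟶ ActionCategory.objEquiv π.ker _ ρ := ⟨k, hk⟩
    exact ⟨X, ⟨Groupoid.isoEquivHom _ _ |>.symm i⟩⟩

theorem isEquivalence_holonomyFunctor [PathConnectedSpace M] [LocallyPathConnectedSpace M]
    (hM : HasSimplyConnectedNhds M) [Small.{max u e} Gh] :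
    (holonomyFunctor (I := I) hπ m).IsEquivalence where
  faithful := faithful_holonomyFunctor hπ m
  full := full_holonomyFunctor hπ m
  essSurj := essSurj_holonomyFunctor hπ m hM

end OrientationTwistedBundle

theorem surjective_of_ne_one {G : Type*} [Group G] {π : G →* ℤˣ} (hπ : π ≠ 1) :
    Function.Surjective π := by
  obtain ⟨g, hg⟩ : ∃ g, π g ≠ 1 := by
    by_contra! h
    exact hπ (MonoidHom.ext h)
  intro a
  rcases Int.units_eq_one_or a with rfl | rfl
  · exact ⟨1, map_one π⟩
  · exact ⟨g, (Int.units_eq_one_or _).resolve_left hg⟩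

theorem proposition3p4 {E : Type*} [NormedAddCommGroup E] [NormedSpace ℝ E]
    [FiniteDimensional ℝ E] {H : Type*} [TopologicalSpace H] (I : ModelWithCorners ℝ E H)
    (M : Type*) [TopologicalSpace M] [ChartedSpace H M] [IsManifold I ∞ M] [ConnectedSpace M]
    (m₀ : M) {Gh : Type*} [Group Gh] [Finite Gh] [TopologicalSpace Gh] [DiscreteTopology Gh]
    (π : Gh →* ℤˣ) (hπ : π ≠ 1) :
    Nonempty (OrientationTwistedBundle I M π ≌ ActionCategory π.ker (TwistedHom I π m₀)) := by
  have := I.locallyPathConnectedSpace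
  have := ChartedSpace.locallyPathConnectedSpace H M
  have : PathConnectedSpace M := pathConnectedSpace_iff_connectedSpace.2 inferInstance
  have := OrientationTwistedBundle.isEquivalence_holonomyFunctor (I := I)
    (surjective_of_ne_one hπ) m₀ (I.hasSimplyConnectedNhds M)
  exact ⟨(OrientationTwistedBundle.holonomyFunctor (surjective_of_ne_one hπ) m₀).asEquivalence⟩
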